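/- Let $\mathcal N$ be a linear electrical network with a finite number $n\ge 3$ of nodes, numbered $1,\dots,n$, and finitely many branches: a finite multigraph in which each branch $\alpha$ joins two different nodes (parallel branches are allowed, the graph need not be connected) and carries an admittance $y_\alpha$ in a commutative ring $R$ (for example $\mathbb R$ or $\mathbb C$). Its admittance matrix $Y$ is the $n\times n$ matrix whose entry $Y_{kk}$ is the sum of the admittances of all branches incident with node $k$, and whose entry $Y_{jk}$, $j\ne k$, is minus the sum of the admittances of all branches joining $j$ and $k$. The Kirchhoff characteristic of a network is $$\kappa(\mathcal N)=\sum_{T}\prod_{\alpha\in T}y_\alpha ,$$ the sum being over all spanning trees $T$ of $\mathcal N$; it is $0$ if $\mathcal N$ is disconnected and $1$ if $\mathcal N$ is a single isolated node. The second cofactor with row indices $p,q$ and column indices $j,k$ of an $n\times n$ matrix $A$ is $$C_{pq,jk}(A)=(-1)^{\sigma(p,q)+\sigma(j,k)}\det A_{(pq,jk)},\qquad \sigma(a,b)=\begin{cases}a+b-1,&a<b,\\ a+b,&\text{otherwise,}\end{cases}$$ where $A_{(pq,jk)}$ is $A$ with rows $p,q$ and columns $j,k$ deleted; $C_{pq,jk}(A)=0$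 if $p=q$ or $j=k$. Contracting a set of node pairs means identifying the two nodes of each pair and deleting every branch whose endpoints become the same node (a pair $(j,j)$ has no effect). Let $j,k,p,q$ be nodes of $\mathcal N$ such that $(j,k)$ and $(p,q)$ are distinct as unordered pairs, that is, $\{j,k\}\neq\{p,q\}$ (the cases $j=k$ and $p=q$ are allowed). Let $\mathcal N^{[jk]}$ and $\mathcal N^{[pq]}$ be the networks obtained from $\mathcal N$ by contracting $(j,k)$ and $(p,q)$ respectively, and let $\mathcal N^{[jk][pq]}$ be obtained by contracting both pairs simultaneously. Then $$\kappa(\mathcal N^{[jk]})\,\kappa(\mathcal N^{[pq]})-\kappa(\mathcal N)\,\kappa(\mathcal N^{[jk][pq]})=C_{pq,jk}(Y)^2 .$$ In particular, if all admittances are real numbers (of any sign), the left-hand side is nonnegative, and it is zero if and only if $C_{pq,jk}(Y)=0$, that is, if and only if $(j,k)$ and $(p,q)$ are conjugate pairs in $\mathcal N$ (which is the definition of conjugate pairs). -/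

import Mathlib

/-- A linear electrical network with nodes `V`, branches `B` and admittances in `R`: a multigraph
(parallel branches are allowed, a branch joins two different nodes) with an admittance on each
branch. Branch orientations are omitted: nothing below depends on them. -/
structure Network (V B R : Type*) where
  /-- the two endpoints of a branch -/
  ends : B → Sym2 V
  /-- the admittance of a branch -/
  adm : B → R
  /-- the endpoints of a branch are different nodes -/
  not_isDiag : ∀ b, ¬ (ends b).IsDiag

/-- The sign exponent `σ(a, b)` of second cofactors: `a + b - 1` if `a < b` and `a + b` otherwise,
for the indices counted from `1`. -/
def cofactorShift {n : ℕ} (a b : Fin n) : ℕ :=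
  if a < b then ((a : ℕ) + 1) + ((b : ℕ) + 1) - 1 else ((a : ℕ) + 1) + ((b : ℕ) + 1)

theorem card_compl_pair {n : ℕ} {a b : Fin n} (h : a ≠ b) :
    ({a, b}ᶜ : Finset (Fin n)).card = n - 2 := by
  rw [Finset.card_compl, Finset.card_pair h, Fintype.card_fin]

/-- The minor obtained from `A` by deleting the rows `j`, `p` and the columns `k`, `q`, the
remaining rows and columns being kept in order. -/
def secondMinor {R : Type*} {n : ℕ} (A : Matrix (Fin n) (Fin n) R) {j p k q : Fin n}
    (hjp : j ≠ p) (hkq : k ≠ q) : Matrix (Fin (n - 2)) (Fin (n - 2)) R :=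
  A.submatrix (Finset.orderEmbOfFin {j, p}ᶜ (card_compl_pair hjp))
    (Finset.orderEmbOfFin {k, q}ᶜ (card_compl_pair hkq))

/-- The second cofactor `C_{jp,kq}(A)` with row indices `j`, `p` and column indices `k`, `q`; it
is `0` by convention if `j = p` or `k = q`. -/
def secondCofactor {R : Type*} [CommRing R] {n : ℕ} (A : Matrix (Fin n) (Fin n) R)
    (j p k q : Fin n) : R :=
  if h : j ≠ p ∧ k ≠ q then
    (-1) ^ (cofactorShift j p + cofactorShift k q) * (secondMinor A h.1 h.2).det
  else 0

namespace Network

variable {V B R : Type*}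

/-- The admittance matrix: a diagonal entry is the sum of the admittances of the branches incident
with the node, an off-diagonal entry is minus the sum of the admittances of the branches joining
the two nodes. -/
def admittanceMatrix [DecidableEq V] [Fintype B] [CommRing R] (N : Network V B R) :
    Matrix V V R :=
  Matrix.of fun j k =>
    if j = k then ∑ b with j ∈ N.ends b, N.adm b
    else -∑ b with N.ends b = s(j, k), N.adm b

/-- A set `T` of branches is a spanning tree if the subgraph with all nodes and with the branches
`T` is connected and has no loops (closed paths without repeated branches): two parallel branches
form a loop, so no two branches in `T` have the same endpoints, and the simple graph with these
branches is a tree. -/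
def IsSpanningTree (N : Network V B R) (T : Finset B) : Prop :=
  Set.InjOn N.ends T ∧ (SimpleGraph.fromEdgeSet (N.ends '' T)).IsTree

/-- The Kirchhoff characteristic: the sum over all spanning trees of the product of the
admittances in the tree. (The network has finitely many branches, so the sum is finite.) It is
`0` for a disconnected network and `1` for an isolated node. -/
noncomputable def kappa [CommRing R] (N : Network V B R) : R :=
  ∑ᶠ (T : Finset B) (_ : N.IsSpanningTree T), ∏ b ∈ T, N.adm b

/-- The equivalence relation on nodes generated by identifying `a` with `b` for all pairs
`(a, b)` in `S`. -/
def identify (S : Set (V × V)) : Setoid V :=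
  Relation.EqvGen.setoid fun a b => (a, b) ∈ S

/-- The network obtained by simultaneously contracting all node pairs in `S`: the nodes of each
pair are identified, and a branch whose two endpoints become the same node is deleted. -/
def contract (N : Network V B R) (S : Set (V × V)) :
    Network (Quotient (identify S))
      {b : B // ¬ ((N.ends b).map (Quotient.mk (identify S))).IsDiag} R where
  ends b := (N.ends b.1).map (Quotient.mk (identify S))
  adm b := N.adm b.1
  not_isDiag b := b.2

/-- The node pairs `(j, k)` and `(p, q)` are conjugate if `C_{pq,jk}(Y) = 0`. -/
def IsConjugate {n : ℕ} [Fintype B] [CommRing R] (N : Network (Fin n) B R)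
    (j k p q : Fin n) : Prop :=
  secondCofactor N.admittanceMatrix p q j k = 0

end Network

/-! Ground node `q` by setting `M = Y + e_q e_qᵀ`. By the matrix tree theorem `det M = κ`. A new
branch of admittance `1` between `a` and `b` adds the rank-one matrix of `e_a - e_b`, and by
deletion and contraction it adds to `κ` the characteristic of the network with `(a, b)` contracted.
Write `u = e_j - e_k`, `v = e_p - e_q`, and let `α`, `β`, `γ` be the characteristics after
contracting `(j, k)`, `(p, q)` and both. Then the determinants of `M`, `M + uuᵀ`, `M + vvᵀ`, `M +
uuᵀ + vvᵀ` are `κ`, `κ + α`, `κ + β`, `κ + α + β + γ`.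

The determinant lemma for an update of rank two of a symmetric matrix gives `κ(κ + α + β + γ) = (κ +
α)(κ + β) - (vᵀ adj(M) u)²`, that is `αβ - κγ = (vᵀ adj(M) u)²`
(`det_mul_det_add_vecMulVec_add_vecMulVec`). Since the rows and columns of `Y` sum to zero, row
operations turn `uᵀ adj(M) v` into the determinant of `Y` with rows `p`, `q` replaced by `e_j`,
`e_k`, which is the second cofactor up to sign (`dotProduct_adjugate_mulVec_sub_single`,
`sq_det_updateRow_updateRow`).

On the combinatorial side, `treeSum` encodes a contraction as an equivalence relation on a fixed
node set, so the branches and their index type never change. Trees are recognised by connectedness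
and the number of branches; `kappa_contract` links this with the contracted networks. -/

namespace Matrix

/-! ### Cauchy-Binet expansion of a sum of rank-one matrices. -/

section RankOne

variable {R m ι : Type*} [CommRing R] [Fintype m] [DecidableEq m] [Fintype ι] [DecidableEq ι]

/-- Row `x` of the matrix is `∑ i, (w i * a i x) • a i`. Multilinearity expands the determinant over
functions `f` from rows to indices; non-injective `f` give two equal rows, and the others are
grouped by their image `T`. The inner sum does not involve `w`. -/
theorem det_sum_smul_vecMulVec_eq_sum_powersetCard_mul (a : ι → m → R) (w : ι → R) :
    det (∑ i, w i • vecMulVec (a i) (a i)) =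
      ∑ T ∈ Finset.univ.powersetCard (Fintype.card m), (∏ i ∈ T, w i) *
        ∑ f : m → ι with Finset.univ.image f = T,
          (∏ x, a (f x) x) * det (of fun x => a (f x)) := by
  have h1 : (∑ i, w i • vecMulVec (a i) (a i)) = of fun x => ∑ i, (w i * a i x) • a i := by
    ext x y
    simp [Matrix.sum_apply, vecMulVec_apply, mul_assoc]
  have h2 : det (of fun x => ∑ i, (w i * a i x) • a i) =
      ∑ f : m → ι, (∏ x, w (f x)) * ((∏ x, a (f x) x) * det (of fun x => a (f x))) := by
    have := (detRowAlternating (R := R) (n := m)).toMultilinearMap.map_sum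
      (fun x i => (w i * a i x) • a i)
    refine this.trans (Finset.sum_congr rfl fun f _ => ?_)
    refine ((detRowAlternating (R := R) (n := m)).toMultilinearMap.map_smul_univ
      (fun x => w (f x) * a (f x) x) (fun x => a (f x))).trans ?_
    rw [Finset.prod_mul_distrib, smul_eq_mul, mul_assoc]
    rfl
  have h0 : ∀ f : m → ι, ¬ Function.Injective f → det (of fun x => a (f x)) = 0 := by
    intro f hf
    obtain ⟨x, y, hxy, hne⟩ := Function.not_injective_iff.1 hf
    exact det_zero_of_row_eq hne (congrArg a hxy)
  rw [h1, h2, ← Finset.sum_fiberwise Finset.univ (fun f : m → ι => Finset.univ.image f)]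
  symm
  rw [Finset.powersetCard_eq_filter, Finset.powerset_univ, Finset.sum_filter]
  refine Finset.sum_congr rfl fun T _ => ?_
  rw [Finset.mul_sum]
  split_ifs with hT
  · refine Finset.sum_congr rfl fun f hf => ?_
    have hf : Finset.univ.image f = T := (Finset.mem_filter.1 hf).2
    congr 1
    subst hf
    exact Finset.prod_image fun x _ y _ h => Finset.card_image_iff.1
      (hT.trans Finset.card_univ.symm) (Finset.mem_coe.2 (Finset.mem_univ x))
      (Finset.mem_coe.2 (Finset.mem_univ y)) h
  · refine (Finset.sum_eq_zero fun f hf => ?_).symm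
    have hf : Finset.univ.image f = T := (Finset.mem_filter.1 hf).2
    rw [h0 f fun hi => hT (by rw [← hf, Finset.card_image_of_injective _ hi, Finset.card_univ])]
    simp

/-- A form of the Cauchy-Binet formula. -/
theorem det_sum_smul_vecMulVec (a : ι → m → R) (w : ι → R) :
    det (∑ i, w i • vecMulVec (a i) (a i)) =
      ∑ T ∈ Finset.univ.powersetCard (Fintype.card m), (∏ i ∈ T, w i) *
        det (∑ i ∈ T, vecMulVec (a i) (a i)) := by
  rw [det_sum_smul_vecMulVec_eq_sum_powersetCard_mul]
  refine Finset.sum_congr rfl fun T hT => ?_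
  have hT := (Finset.mem_powersetCard.1 hT).2
  congr 1
  -- The inner sum is identified by the same expansion with the indicator of `T` as weights: among
  -- sets of this cardinality, only `T` itself lies inside `T`.
  have h1 : ∑ i ∈ T, vecMulVec (a i) (a i) =
      ∑ i, (if i ∈ T then (1 : R) else 0) • vecMulVec (a i) (a i) := by
    simp [ite_smul, Finset.sum_ite_mem]
  rw [h1, det_sum_smul_vecMulVec_eq_sum_powersetCard_mul, Finset.sum_eq_single T]
  · rw [Finset.prod_eq_one fun i hi => if_pos hi, one_mul]
  · intro T' hT' hne
    have hT' := (Finset.mem_powersetCard.1 hT').2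
    have : ¬ T' ⊆ T := fun h => hne (Finset.eq_of_subset_of_card_le h (by omega))
    obtain ⟨i, hi, hi'⟩ := Finset.not_subset.1 this
    rw [Finset.prod_eq_zero hi (if_neg hi'), zero_mul]
  · intro h
    exact absurd (Finset.mem_powersetCard.2 ⟨Finset.subset_univ _, hT⟩) h

end RankOne

/-! ### Determinants of low-rank updates, without division. -/

section Lemma

variable {R m ι : Type*} [CommRing R] [Fintype m] [DecidableEq m] [Fintype ι] [DecidableEq ι]

theorem det_pow_mul_det_add_mul_of_isUnit {k : ℕ} (hk : Fintype.card ι = k + 1)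
    (A : Matrix m m R) (U : Matrix m ι R) (W : Matrix ι m R) (hA : IsUnit A.det) :
    A.det ^ k * det (A + U * W) = det (A.det • 1 + W * A.adjugate * U) := by
  have h : A.adjugate = A.det • A⁻¹ := by
    rw [inv_def, smul_smul, Ring.mul_inverse_cancel _ hA, one_smul]
  rw [det_add_mul U W hA, h, Matrix.mul_smul, Matrix.smul_mul, ← smul_add, det_smul, hk]
  ring

theorem det_pow_mul_det_add_mul_of_injective {S : Type*} [CommRing S] (φ : R →+* S)
    (hφ : Function.Injective φ) {k : ℕ}
    (A : Matrix m m R) (U : Matrix m ι R) (W : Matrix ι m R)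
    (h : (A.map φ).det ^ k * det (A.map φ + U.map φ * W.map φ) =
      det ((A.map φ).det • 1 + W.map φ * (A.map φ).adjugate * U.map φ)) :
    A.det ^ k * det (A + U * W) = det (A.det • 1 + W * A.adjugate * U) := by
  apply hφ
  rw [map_mul, map_pow, RingHom.map_det, RingHom.map_det, RingHom.map_det]
  simp only [RingHom.mapMatrix_apply]
  convert h using 2
  · rw [Matrix.map_add _ (map_add φ), Matrix.map_mul]
  · rw [Matrix.map_add _ (map_add φ), Matrix.map_mul, Matrix.map_mul]
    congr 1
    · ext i j
      have := RingHom.map_det φ A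
      rw [RingHom.mapMatrix_apply] at this
      by_cases hij : i = j <;> simp [hij, this]
    · have := RingHom.map_adjugate φ A
      rw [RingHom.mapMatrix_apply, RingHom.mapMatrix_apply] at this
      rw [this]

theorem det_pow_mul_det_add_mul_of_mem_nonZeroDivisors {k : ℕ} (hk : Fintype.card ι = k + 1)
    (A : Matrix m m R) (U : Matrix m ι R) (W : Matrix ι m R)
    (hA : A.det ∈ nonZeroDivisors R) :
    A.det ^ k * det (A + U * W) = det (A.det • 1 + W * A.adjugate * U) := by
  refine det_pow_mul_det_add_mul_of_injective (algebraMap R (FractionRing R))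
    (IsFractionRing.injective R (FractionRing R)) A U W
    (det_pow_mul_det_add_mul_of_isUnit hk _ _ _ ?_)
  have := IsLocalization.map_units (FractionRing R) (⟨_, hA⟩ : nonZeroDivisors R)
  rwa [RingHom.map_det] at this

open Polynomial in
/-- The matrix determinant lemma over an arbitrary commutative ring. -/
theorem det_pow_mul_det_add_mul {k : ℕ} (hk : Fintype.card ι = k + 1)
    (A : Matrix m m R) (U : Matrix m ι R) (W : Matrix ι m R) :
    A.det ^ k * det (A + U * W) = det (A.det • 1 + W * A.adjugate * U) := by
  -- The determinant of `X + A` is the monic characteristic polynomial of `-A`, hence not a zero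
  -- divisor. The identity holds for `X + A` and is then evaluated at `X = 0`.
  let A' : Matrix m m R[X] := (X : R[X]) • 1 + A.map C
  have hA' : A'.det ∈ nonZeroDivisors R[X] := by
    have : A'.det = (-A).charpoly := by
      rw [charpoly, charmatrix]
      congr 1
      ext i j
      simp [A', one_apply, diagonal_apply]
    rw [this]
    exact (charpoly_monic _).mem_nonZeroDivisors
  have h := congrArg (evalRingHom (0 : R))
    (det_pow_mul_det_add_mul_of_mem_nonZeroDivisors hk A' (U.map C) (W.map C) hA')
  have e1 : A'.map (evalRingHom (0 : R)) = A := by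
    ext i j
    by_cases hij : i = j <;> simp [A', hij]
  have e2 : (U.map C).map (evalRingHom (0 : R)) = U := by ext; simp
  have e3 : (W.map C).map (evalRingHom (0 : R)) = W := by ext; simp
  have e4 : evalRingHom (0 : R) A'.det = A.det := by
    rw [RingHom.map_det, RingHom.mapMatrix_apply, e1]
  rw [map_mul, map_pow, e4, RingHom.map_det, RingHom.map_det] at h
  simp only [RingHom.mapMatrix_apply] at h
  rw [Matrix.map_add _ (map_add (evalRingHom (0:R))), Matrix.map_mul, e1, e2, e3,
    Matrix.map_add _ (map_add (evalRingHom (0:R))), Matrix.map_mul, Matrix.map_mul, e2, e3] at h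
  have e5 : A'.adjugate.map (evalRingHom (0 : R)) = A.adjugate := by
    have := RingHom.map_adjugate (evalRingHom (0 : R)) A'
    rwa [RingHom.mapMatrix_apply, RingHom.mapMatrix_apply, e1] at this
  have e6 : (A'.det • (1 : Matrix ι ι R[X])).map (evalRingHom (0 : R)) =
      A.det • (1 : Matrix ι ι R) := by
    ext i j
    rw [← e4]
    by_cases hij : i = j <;> simp [hij]
  rwa [e5, e6] at h

theorem det_add_vecMulVec (A : Matrix m m R) (u v : m → R) :
    det (A + vecMulVec u v) = A.det + v ⬝ᵥ (A.adjugate *ᵥ u) := by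
  have h := det_pow_mul_det_add_mul (ι := Unit) (k := 0) (by simp) A
    (replicateCol Unit u) (replicateRow Unit v)
  rw [pow_zero, one_mul] at h
  rw [vecMulVec_eq Unit, h, det_unique]
  simp only [Matrix.add_apply, smul_apply, one_apply_eq, smul_eq_mul, mul_one]
  rw [dotProduct_mulVec]
  congr 1

theorem det_mul_det_add_vecMulVec_add_vecMulVec (A : Matrix m m R) (hA : A.IsSymm)
    (u v : m → R) :
    A.det * det (A + vecMulVec u u + vecMulVec v v) =
      det (A + vecMulVec u u) * det (A + vecMulVec v v) - (v ⬝ᵥ (A.adjugate *ᵥ u)) ^ 2 := by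
  have h := det_pow_mul_det_add_mul (ι := Fin 2) (k := 1) (by simp) A
    (of fun x i => ![u, v] i x) (of ![u, v])
  have e1 : A + (of fun x i => ![u, v] i x) * of ![u, v] =
      A + vecMulVec u u + vecMulVec v v := by
    ext x y
    simp [mul_apply, Fin.sum_univ_two, vecMulVec_apply, add_assoc]
  have e2 : ∀ i j, (of ![u, v] * A.adjugate * of fun x i => ![u, v] i x) i j =
      ![u, v] i ⬝ᵥ (A.adjugate *ᵥ ![u, v] j) := by
    intro i j
    rw [dotProduct_mulVec]
    rfl
  -- Symmetry of `A` makes the two off-diagonal entries of the `2 × 2` determinant equal, so their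
  -- product is a square.
  have hs : u ⬝ᵥ (A.adjugate *ᵥ v) = v ⬝ᵥ (A.adjugate *ᵥ u) := by
    have : A.adjugateᵀ = A.adjugate := by rw [adjugate_transpose, hA.eq]
    rw [dotProduct_mulVec, dotProduct_comm, ← mulVec_transpose, this]
  rw [e1, pow_one] at h
  rw [h, det_fin_two]
  simp only [Matrix.add_apply, e2]
  simp [hs, det_add_vecMulVec]
  ring

end Lemma

/-! ### Second cofactors as values of the adjugate form. -/

section Cofactor

variable {R : Type*} [CommRing R]

theorem det_eq_zero_of_mulVec_eq_zero_of_apply_eq_one {m : Type*} [Fintype m] [DecidableEq m]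
    (A : Matrix m m R) {c : m → R} (h : A *ᵥ c = 0) {x : m} (hx : c x = 1) : A.det = 0 := by
  have : A.adjugate *ᵥ (A *ᵥ c) = A.det • c := by
    rw [mulVec_mulVec, adjugate_mul, smul_mulVec, one_mulVec]
  rw [h, mulVec_zero] at this
  simpa [hx] using (congrFun this x).symm

theorem sq_det_submatrix_equiv {m l : Type*} [Fintype m] [DecidableEq m] [Fintype l]
    [DecidableEq l] (A : Matrix m m R) (e f : l ≃ m) :
    (A.submatrix e f).det ^ 2 = A.det ^ 2 := by
  have : A.submatrix e f = (A.submatrix f f).submatrix (e.trans f.symm) id := by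
    ext; simp
  rw [this, det_permute, det_submatrix_equiv_self, mul_pow]
  rcases Int.units_eq_one_or (Equiv.Perm.sign (e.trans f.symm)) with h | h <;> simp [h]

theorem orderEmbOfFin_compl_pair_ne {n : ℕ} {a b : Fin n} (h : a ≠ b) (x : Fin (n - 2)) :
    Finset.orderEmbOfFin {a, b}ᶜ (card_compl_pair h) x ≠ a ∧
      Finset.orderEmbOfFin {a, b}ᶜ (card_compl_pair h) x ≠ b := by
  have := Finset.orderEmbOfFin_mem {a, b}ᶜ (card_compl_pair h) x
  rwa [Finset.mem_compl, Finset.mem_insert, Finset.mem_singleton, not_or] at this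

theorem exists_equiv_sum_fin_two {n : ℕ} {a b : Fin n} (h : a ≠ b) :
    ∃ e : Fin (n - 2) ⊕ Fin 2 ≃ Fin n,
      (∀ x, e (Sum.inl x) = Finset.orderEmbOfFin {a, b}ᶜ (card_compl_pair h) x) ∧
      e (Sum.inr 0) = a ∧ e (Sum.inr 1) = b := by
  have hne := orderEmbOfFin_compl_pair_ne h
  have hi : Function.Injective (Sum.elim
      (Finset.orderEmbOfFin {a, b}ᶜ (card_compl_pair h)) ![a, b]) := by
    refine Function.Injective.sumElim (RelEmbedding.injective _) ?_ ?_
    · intro x y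
      fin_cases x <;> fin_cases y <;> simp [h, h.symm]
    · intro x y
      fin_cases y
      · exact (hne x).1
      · exact (hne x).2
  have hn : 2 ≤ n := by
    have := Finset.card_le_univ ({a, b} : Finset (Fin n))
    rwa [Finset.card_pair h, Fintype.card_fin] at this
  refine ⟨Equiv.ofBijective _ ((Fintype.bijective_iff_injective_and_card _).2 ⟨hi, ?_⟩),
    fun x => rfl, rfl, rfl⟩
  simp only [Fintype.card_sum, Fintype.card_fin]
  omega

/-- Moving rows `p`, `q` and columns `j`, `k` to the end gives a block triangular matrix with corner
`1`. Squaring removes the signs of the reorderings as well as the cofactor sign. -/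
theorem sq_det_updateRow_updateRow {n : ℕ} (A : Matrix (Fin n) (Fin n) R) {p q j k : Fin n}
    (hpq : p ≠ q) (hjk : j ≠ k) :
    ((A.updateRow p (Pi.single j 1)).updateRow q (Pi.single k 1)).det ^ 2 =
      secondCofactor A p q j k ^ 2 := by
  obtain ⟨e, he, he0, he1⟩ := exists_equiv_sum_fin_two hpq
  obtain ⟨f, hf, hf0, hf1⟩ := exists_equiv_sum_fin_two hjk
  have hsgn : (((-1 : R) ^ (cofactorShift p q + cofactorShift j k))) ^ 2 = 1 := by
    rw [← pow_mul, mul_comm, pow_mul, neg_one_sq, one_pow]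
  rw [secondCofactor, dif_pos ⟨hpq, hjk⟩, mul_pow, hsgn, one_mul,
    ← sq_det_submatrix_equiv _ e f]
  have hb : ((A.updateRow p (Pi.single j 1)).updateRow q (Pi.single k 1)).submatrix e f =
      fromBlocks (secondMinor A hpq hjk)
        (of fun x y => A (e (Sum.inl x)) (f (Sum.inr y))) 0 1 := by
    have h1 := fun x => he x ▸ orderEmbOfFin_compl_pair_ne hpq x
    have h2 := fun x => hf x ▸ orderEmbOfFin_compl_pair_ne hjk x
    ext (x | x) (y | y)
    · rw [submatrix_apply, updateRow_ne (h1 x).2, updateRow_ne (h1 x).1, he, hf]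
      rfl
    · simp [updateRow_apply, h1]
    · fin_cases x <;> simp [updateRow_apply, he0, he1, hpq, h2]
    · fin_cases x <;> fin_cases y <;>
        simp [updateRow_apply, he0, he1, hf0, hf1, hpq, hjk, hjk.symm]
  rw [hb, det_fromBlocks_zero₂₁, det_one, mul_one]

theorem dotProduct_adjugate_mulVec_single {m : Type*} [Fintype m] [DecidableEq m]
    (A : Matrix m m R) (u : m → R) (y : m) :
    u ⬝ᵥ (A.adjugate *ᵥ Pi.single y 1) = (A.updateRow y u).det := by
  rw [← cramer_transpose_apply, cramer_eq_adjugate_mulVec, ← adjugate_transpose,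
    mulVec_transpose, dotProduct_mulVec]
  simp

/-- The left side is a difference of two determinants, with `u` in row `p` and in row `q` of `M`. A
swap of rows merges them into one, with `u` in row `p` and `M q + M p` in row `q`. The latter
becomes `e_q` because the rows of `M` sum to `e_q`, then `e_k` because the rows of `Y` have zero
entry sums; finally `e_k` drops out of `u`. -/
theorem dotProduct_adjugate_mulVec_sub_single {m : Type*} [Fintype m] [DecidableEq m]
    (Y : Matrix m m R) (hr : Y *ᵥ 1 = 0) (hc : 1 ᵥ* Y = 0) {p q j k : m}
    (hpq : p ≠ q) :
    (Pi.single j 1 - Pi.single k 1) ⬝ᵥ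
        ((Y + vecMulVec (Pi.single q 1) (Pi.single q 1)).adjugate *ᵥ
          (Pi.single p 1 - Pi.single q 1)) =
      ((Y.updateRow p (Pi.single j 1)).updateRow q (Pi.single k 1)).det := by
  set u : m → R := Pi.single j 1 - Pi.single k 1 with hu
  set M := Y + vecMulVec (Pi.single q 1) (Pi.single q 1) with hM
  have hMr : ∀ x, x ≠ q → M x = Y x := by
    intro x hx
    ext y
    simp [hM, vecMulVec_apply, hx]
  have hsum : ∀ y, ∑ x, M x y = (Pi.single q 1 : m → R) y := by
    intro y
    have := congrFun hc y
    simp only [vecMul, dotProduct, Pi.one_apply, one_mul, Pi.zero_apply] at this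
    simp [hM, Finset.sum_add_distrib, vecMulVec_apply, this, Pi.single_apply, eq_comm]
  have h1 : (M.updateRow q u).det = - ((M.updateRow p u).updateRow q (M p)).det := by
    have h : (M.updateRow p u).updateRow q (M p) =
        (M.updateRow q u).submatrix (Equiv.swap p q) id := by
      ext x y
      by_cases hx : x = q
      · subst hx; simp [hpq]
      · by_cases hx' : x = p
        · subst hx'; simp [hpq]
        · simp [hx, hx', Equiv.swap_apply_of_ne_of_ne hx' hx]
    rw [h, det_permute, Equiv.Perm.sign_swap hpq]
    simp
  have h2 : (M.updateRow p u).det = ((M.updateRow p u).updateRow q (M q)).det := by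
    congr 1
    ext x y
    by_cases hx : x = q
    · subst hx; simp [hpq.symm]
    · simp [hx]
  have h3 : ((M.updateRow p u).updateRow q (M q + M p)).det =
      ((M.updateRow p u).updateRow q (Pi.single q 1)).det := by
    set N := (M.updateRow p u).updateRow q (Pi.single q 1) with hN
    -- The column sums give `M q + M p = e_q - ∑ M x` over `x ≠ p, q`, a combination of the rows of
    -- `N` with coefficient `1` at `q`.
    have := det_updateRow_sum N q (fun x => if x = q then 1 else if x = p then 0 else -1)
    simp only [if_true, one_smul] at this
    rw [← this, hN, updateRow_idem]
    congr 2
    ext y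
    have hx : ∀ x, ((if x = q then (1 : R) else if x = p then 0 else -1) •
        ((M.updateRow p u).updateRow q (Pi.single q 1)) x) y =
        (if x = q then (Pi.single q 1 : m → R) y + M q y else 0) +
          (if x = p then M p y else 0) - M x y := by
      intro x
      by_cases hx : x = q
      · subst hx; simp [hpq.symm]
      · by_cases hx' : x = p
        · subst hx'; simp [hpq]
        · simp [hx, hx']
    refine Eq.trans ?_ (Finset.sum_apply y Finset.univ fun x =>
      ((if x = q then (1 : R) else if x = p then 0 else -1) •
        ((M.updateRow p u).updateRow q (Pi.single q 1)) x : m → R)).symm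
    rw [Finset.sum_congr rfl fun x _ => hx x, Finset.sum_sub_distrib,
      Finset.sum_add_distrib, hsum]
    simp only [Finset.sum_ite_eq', Finset.mem_univ, if_true]
    exact (by ring : M q y + M p y =
      (Pi.single q 1 : m → R) y + M q y + M p y - (Pi.single q 1 : m → R) y)
  have h4 : (M.updateRow p u).updateRow q (Pi.single q 1) =
      (Y.updateRow p u).updateRow q (Pi.single q 1) := by
    ext x y
    by_cases hx : x = q
    · subst hx; simp
    · by_cases hx' : x = p <;> simp [hx, hx', updateRow_apply, hMr]
  -- Every row now has entry sum zero, so the all-ones vector is in the kernel.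
  have h5 : ((Y.updateRow p u).updateRow q (Pi.single q 1 - Pi.single k 1)).det = 0 := by
    refine det_eq_zero_of_mulVec_eq_zero_of_apply_eq_one _ (c := 1) ?_ (x := p) rfl
    ext x
    have := congrFun hr x
    by_cases hx : x = q
    · subst hx; simp [mulVec, dotProduct]
    · by_cases hx' : x = p
      · subst hx'; simp [mulVec, hx, hu, dotProduct]
      · simpa [mulVec, hx, hx'] using this
  rw [mulVec_sub, dotProduct_sub, dotProduct_adjugate_mulVec_single,
    dotProduct_adjugate_mulVec_single, h1, h2, sub_neg_eq_add, ← det_updateRow_add, h3, h4]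
  rw [sub_eq_add_neg, det_updateRow_add, ← neg_one_smul R, det_updateRow_smul] at h5
  have h6 : ((Y.updateRow p u).updateRow q (Pi.single q 1)).det =
      ((Y.updateRow p u).updateRow q (Pi.single k 1)).det := by
    linear_combination h5
  have h7 : ((Y.updateRow p (Pi.single k 1)).updateRow q (Pi.single k 1)).det = 0 :=
    det_zero_of_row_eq hpq (by rw [updateRow_ne hpq, updateRow_self, updateRow_self])
  rw [h6, updateRow_comm _ hpq, hu, sub_eq_add_neg, det_updateRow_add, ← neg_one_smul R,
    det_updateRow_smul, updateRow_comm _ hpq.symm, updateRow_comm _ hpq.symm, h7, mul_zero,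
    add_zero]

end Cofactor

end Matrix

namespace Network

/-! ### Equivalence relations generated by branches and node pairs. -/

section Setoid

variable {V I : Type*}

/-- The equivalence relation on nodes generated by the branches in `T`. -/
def branchSetoid (ends : I → Sym2 V) (T : Set I) : Setoid V :=
  Relation.EqvGen.setoid fun x y => ∃ i ∈ T, ends i = s(x, y)

theorem branchSetoid_le_iff {ends : I → Sym2 V} {T : Set I} {r : Setoid V} :
    branchSetoid ends T ≤ r ↔ ∀ i ∈ T, ∀ x y, ends i = s(x, y) → r x y :=
  ⟨fun h i hi _ _ hxy => h (Relation.EqvGen.rel _ _ ⟨i, hi, hxy⟩),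
    fun h => Setoid.eqvGen_le fun x y ⟨i, hi, hxy⟩ => h i hi x y hxy⟩

theorem branchSetoid_rel {ends : I → Sym2 V} {T : Set I} {i : I} (hi : i ∈ T) {x y : V}
    (h : ends i = s(x, y)) : branchSetoid ends T x y :=
  Relation.EqvGen.rel _ _ ⟨i, hi, h⟩

theorem identify_le_iff {S : Set (V × V)} {r : Setoid V} :
    identify S ≤ r ↔ ∀ a b, (a, b) ∈ S → r a b :=
  ⟨fun h _ _ hab => h (Relation.EqvGen.rel _ _ hab), fun h => Setoid.eqvGen_le h⟩

theorem identify_rel {S : Set (V × V)} {a b : V} (h : (a, b) ∈ S) : identify S a b :=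
  Relation.EqvGen.rel _ _ h

theorem identify_insert (a b : V) (S : Set (V × V)) :
    identify (insert (a, b) S) = identify {(a, b)} ⊔ identify S := by
  refine le_antisymm (identify_le_iff.2 fun x y h => ?_)
    (sup_le (identify_le_iff.2 fun x y h => identify_rel (Or.inl h))
      (identify_le_iff.2 fun x y h => identify_rel (Or.inr h)))
  rcases h with h | h
  · exact (le_sup_left : _ ≤ identify {(a, b)} ⊔ identify S) (identify_rel h)
  · exact (le_sup_right : _ ≤ identify {(a, b)} ⊔ identify S) (identify_rel h)

theorem identify_singleton_self (a : V) : identify {(a, a)} = ⊥ :=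
  le_bot_iff.1 <| identify_le_iff.2 fun x y h => by
    obtain ⟨rfl, rfl⟩ := Prod.mk.inj h
    exact Setoid.refl' _ _

theorem sym2_eq_of_identify_singleton {a b x y : V} (h : identify {(a, b)} x y) (hxy : x ≠ y) :
    s(x, y) = s(a, b) := by
  suffices H : ∀ x y, identify {(a, b)} x y → x = y ∨ s(x, y) = s(a, b) from
    (H x y h).resolve_left hxy
  intro x y h
  induction h with
  | rel x y h =>
    obtain ⟨rfl, rfl⟩ := Prod.mk.inj h
    exact Or.inr rfl
  | refl x => exact Or.inl rfl
  | symm x y _ ih => exact ih.imp Eq.symm fun h => Sym2.eq_swap.trans h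
  | trans x y z _ _ h1 h2 =>
    rcases h1 with rfl | h1
    · exact h2
    · rcases h2 with rfl | h2
      · exact Or.inr h1
      · left
        rw [← h2, Sym2.eq_swap] at h1
        exact Sym2.congr_right.1 h1

theorem branchSetoid_empty (ends : I → Sym2 V) : branchSetoid ends ∅ = ⊥ :=
  le_bot_iff.1 <| branchSetoid_le_iff.2 fun _ h => h.elim

theorem branchSetoid_mono (ends : I → Sym2 V) {T T' : Set I} (h : T ⊆ T') :
    branchSetoid ends T ≤ branchSetoid ends T' :=
  branchSetoid_le_iff.2 fun _ hi _ _ hxy => branchSetoid_rel (h hi) hxy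

theorem branchSetoid_insert (ends : I → Sym2 V) {i : I} (T : Set I) {a b : V}
    (h : ends i = s(a, b)) :
    branchSetoid ends (insert i T) = identify {(a, b)} ⊔ branchSetoid ends T := by
  have hr : (identify {(a, b)} ⊔ branchSetoid ends T) a b :=
    (le_sup_left : identify {(a, b)} ≤ _) (identify_rel rfl)
  refine le_antisymm (branchSetoid_le_iff.2 fun k hk x y hxy => ?_)
    (sup_le (identify_le_iff.2 fun x y hxy => ?_) (branchSetoid_mono _ (Set.subset_insert _ _)))
  · rcases hk with rfl | hk
    · rcases Sym2.eq_iff.1 (h.symm.trans hxy) with ⟨rfl, rfl⟩ | ⟨rfl, rfl⟩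
      · exact hr
      · exact Setoid.symm' _ hr
    · exact (le_sup_right : branchSetoid ends T ≤ identify {(a, b)} ⊔ branchSetoid ends T)
        (branchSetoid_rel hk hxy)
  · obtain ⟨rfl, rfl⟩ := Prod.mk.inj hxy
    exact branchSetoid_rel (Set.mem_insert _ _) h

theorem card_quotient_bot : Nat.card (Quotient (⊥ : Setoid V)) = Nat.card V :=
  (Nat.card_congr (Equiv.ofBijective _ ⟨fun _ _ h => Quotient.exact h,
    Quotient.mk_surjective⟩)).symm

theorem sup_identify_singleton_of_rel {r : Setoid V} {a b : V} (h : r a b) :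
    r ⊔ identify {(a, b)} = r :=
  sup_eq_left.2 <| identify_le_iff.2 fun x y hxy => by
    obtain ⟨rfl, rfl⟩ := Prod.mk.inj hxy
    exact h

theorem card_quotient_sup_identify [Finite V] {r : Setoid V} {a b : V} (h : ¬ r a b) :
    Nat.card (Quotient (r ⊔ identify {(a, b)})) + 1 = Nat.card (Quotient r) := by
  classical
  -- `g` redirects the class of `b` to that of `a`. Its kernel is the enlarged relation and its
  -- range misses exactly the class of `b`.
  let g : V → Quotient r := fun x => if r x b then Quotient.mk r a else Quotient.mk r x
  have hab : (r ⊔ identify {(a, b)}) a b :=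
    (le_sup_right : _ ≤ r ⊔ identify {(a, b)}) (identify_rel rfl)
  have hle : r ≤ r ⊔ identify {(a, b)} := le_sup_left
  have hg : ∀ x, Quotient.mk (r ⊔ identify {(a, b)}) x =
      Quotient.map id (fun _ _ h => hle h) (g x) := by
    intro x
    by_cases hx : r x b
    · simp only [g, hx, if_true]
      exact Quotient.sound (Setoid.trans' _ (hle hx) (Setoid.symm' _ hab))
    · simp only [g, hx, if_false]
      rfl
  have hker : r ⊔ identify {(a, b)} = Setoid.ker g := by
    refine le_antisymm (sup_le ?_ (identify_le_iff.2 ?_)) fun x y hxy => ?_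
    · intro x y hxy
      have : r x b ↔ r y b :=
        ⟨fun h => Setoid.trans' _ (Setoid.symm' _ hxy) h, fun h => Setoid.trans' _ hxy h⟩
      rw [Setoid.ker_def]
      simp only [g, this]
      split_ifs
      · rfl
      · exact Quotient.sound hxy
    · intro x y hxy
      obtain ⟨rfl, rfl⟩ := Prod.mk.inj hxy
      rw [Setoid.ker_def]
      simp [g]
    · have := (hg x).trans ((congrArg _ (Setoid.ker_def.1 hxy)).trans (hg y).symm)
      exact Quotient.exact this
  have hrange : Set.range g = {Quotient.mk r b}ᶜ := by
    ext X
    simp only [Set.mem_range, Set.mem_compl_iff, Set.mem_singleton_iff]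
    constructor
    · rintro ⟨x, rfl⟩ hx
      by_cases hxb : r x b
      · simp only [g, hxb, if_true] at hx
        exact h (Quotient.exact hx)
      · simp only [g, hxb, if_false] at hx
        exact hxb (Quotient.exact hx)
    · induction X using Quotient.inductionOn with
      | h x =>
        intro hx
        refine ⟨x, if_neg fun hxb => hx (Quotient.sound hxb)⟩
  rw [hker, Nat.card_congr (Setoid.quotientKerEquivRange g), hrange, Nat.card_coe_set_eq,
    ← Set.ncard_add_ncard_compl {Quotient.mk r b}, Set.ncard_singleton, add_comm]

theorem card_quotient_le_card_quotient_sup_identify [Finite V] (r : Setoid V) (a b : V) :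
    Nat.card (Quotient r) ≤ Nat.card (Quotient (r ⊔ identify {(a, b)})) + 1 := by
  by_cases h : r a b
  · rw [sup_identify_singleton_of_rel h]
    omega
  · exact (card_quotient_sup_identify h).ge

/-- Each branch lowers the number of classes by at most one, and a single class (or none) remains at
the end. -/
theorem card_quotient_le_card_add_one [Finite V] {ends : I → Sym2 V} (T : Finset I)
    {r : Setoid V} (h : r ⊔ branchSetoid ends T = ⊤) :
    Nat.card (Quotient r) ≤ T.card + 1 := by
  classical
  induction T using Finset.induction_on generalizing r with
  | empty =>
    rw [Finset.coe_empty, branchSetoid_empty, sup_bot_eq] at h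
    subst h
    have : Subsingleton (Quotient (⊤ : Setoid V)) :=
      ⟨fun x y => Quotient.inductionOn₂ x y fun _ _ => Quotient.sound trivial⟩
    exact (Finite.card_le_one_iff_subsingleton.2 this).trans (by simp)
  | insert i T hi ih =>
    obtain ⟨a, b, hab⟩ : ∃ a b, ends i = s(a, b) :=
      (ends i).ind fun a b => ⟨a, b, rfl⟩
    rw [Finset.coe_insert, branchSetoid_insert _ _ hab, ← sup_assoc] at h
    have := card_quotient_le_card_quotient_sup_identify r a b
    have := ih h
    rw [Finset.card_insert_of_notMem hi]
    omega

end Setoid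

/-! ### Weighted tree sums, deletion and contraction. -/

section TreeSum

variable {V I R : Type*} [CommRing R]

theorem sum_finset_option [Fintype I] {M : Type*} [AddCommMonoid M]
    (f : Finset (Option I) → M) :
    ∑ T, f T = ∑ T : Finset I, f (T.map .some) + ∑ T : Finset I, f (Finset.insertNone T) := by
  classical
  rw [← Finset.sum_filter_add_sum_filter_not Finset.univ (fun T => none ∉ T)]
  congr 1
  · refine Finset.sum_nbij' (fun T => Finset.eraseNone T) (fun T => T.map .some) ?_ ?_ ?_ ?_ ?_
    · simp
    · simp
    · intro T hT
      simpa using hT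
    · simp
    · intro T hT
      rw [Finset.map_some_eraseNone, Finset.erase_eq_of_notMem (by simpa using hT)]
  · refine Finset.sum_nbij' (fun T => Finset.eraseNone T) (fun T => Finset.insertNone T)
      ?_ ?_ ?_ ?_ ?_
    · simp
    · simp
    · intro T hT
      rw [Finset.insertNone_eraseNone, Finset.insert_eq_of_mem (by simpa using hT)]
    · simp
    · intro T hT
      rw [Finset.insertNone_eraseNone, Finset.insert_eq_of_mem (by simpa using hT)]

open Classical in
/-- The sum over all spanning trees of the multigraph obtained by identifying the nodes that are
equivalent under `r`. -/
noncomputable def treeSum [Fintype I] (r : Setoid V) (ends : I → Sym2 V) (w : I → R) : R :=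
  ∑ T : Finset I, if T.card + 1 = Nat.card (Quotient r) ∧ r ⊔ branchSetoid ends T = ⊤ then
    ∏ i ∈ T, w i else 0

theorem branchSetoid_map_some (ends : I → Sym2 V) (e : Sym2 V) (T : Finset I) :
    branchSetoid (fun o : Option I => o.elim e ends) (T.map .some) = branchSetoid ends T := by
  unfold branchSetoid
  congr 1
  ext x y
  simp

theorem branchSetoid_insertNone (ends : I → Sym2 V) (a b : V) (T : Finset I) :
    branchSetoid (fun o : Option I => o.elim s(a, b) ends) (Finset.insertNone T) =
      identify {(a, b)} ⊔ branchSetoid ends T := by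
  have : ((Finset.insertNone T : Finset (Option I)) : Set (Option I)) =
      insert none ((T.map .some : Finset (Option I)) : Set (Option I)) := by
    ext (_ | x) <;> simp
  rw [this, branchSetoid_insert (a := a) (b := b) _ _ (by rfl), branchSetoid_map_some]

/-- Deletion and contraction of a branch. -/
theorem treeSum_option [Finite V] [Fintype I] {r : Setoid V} {a b : V} (h : ¬ r a b)
    (ends : I → Sym2 V) (w : I → R) :
    treeSum r (fun o : Option I => o.elim s(a, b) ends) (fun o => o.elim 1 w) =
      treeSum r ends w + treeSum (r ⊔ identify {(a, b)}) ends w := by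
  classical
  rw [treeSum, sum_finset_option]
  congr 1
  · refine Finset.sum_congr rfl fun T _ => ?_
    rw [branchSetoid_map_some, Finset.card_map, Finset.prod_map]
    rfl
  · refine Finset.sum_congr rfl fun T _ => ?_
    rw [branchSetoid_insertNone, Finset.card_insertNone, Finset.prod_insertNone,
      ← card_quotient_sup_identify h, sup_assoc]
    exact if_congr (and_congr_left' (add_left_inj 1)) (one_mul _) rfl

end TreeSum

/-! ### The weighted matrix tree theorem. -/

section MatrixTree

open Matrix

variable {V I R : Type*} [CommRing R]

theorem mk_out (e : Sym2 V) : s(e.out.1, e.out.2) = e := Quot.out_eq e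

theorem sum_vecMulVec_mulVec [Fintype V] (a : I → V → R) (T : Finset I) (c : V → R) :
    (∑ i ∈ T, vecMulVec (a i) (a i)) *ᵥ c = ∑ i ∈ T, (a i ⬝ᵥ c) • a i := by
  rw [sum_mulVec]
  refine Finset.sum_congr rfl fun i _ => ?_
  ext x
  simp [vecMulVec_mulVec, mul_comm]

variable [DecidableEq V]

/-- The incidence vector of a branch with the given endpoints, for some orientation. -/
noncomputable def incVec (R : Type*) [CommRing R] (e : Sym2 V) : V → R :=
  Pi.single e.out.1 1 - Pi.single e.out.2 1

theorem incVec_mk (a b : V) :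
    incVec R s(a, b) = Pi.single a 1 - Pi.single b 1 ∨
      incVec R s(a, b) = -(Pi.single a 1 - Pi.single b 1) := by
  rcases Sym2.eq_iff.1 (mk_out s(a, b)) with ⟨h1, h2⟩ | ⟨h1, h2⟩
  · left; rw [incVec, h1, h2]
  · right; rw [incVec, h1, h2, neg_sub]

theorem vecMulVec_incVec_mk (a b : V) :
    vecMulVec (incVec R s(a, b)) (incVec R s(a, b)) =
      vecMulVec (Pi.single a 1 - Pi.single b 1) (Pi.single a 1 - Pi.single b 1) := by
  rcases incVec_mk (R := R) a b with h | h <;> rw [h]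
  rw [neg_vecMulVec, vecMulVec_neg, neg_neg]

theorem incVec_dotProduct [Fintype V] (e : Sym2 V) (c : V → R) :
    incVec R e ⬝ᵥ c = c e.out.1 - c e.out.2 := by
  simp [incVec, sub_dotProduct]

theorem map_incVec (e : Sym2 V) (x : V) : ((incVec ℤ e x : ℤ) : R) = incVec R e x := by
  simp [incVec, Pi.single_apply]

variable [Fintype V]

theorem det_sum_incVec_eq_zero [Nonempty V] (ends : I → Sym2 V) (T : Finset I) :
    det (∑ i ∈ T, vecMulVec (incVec R (ends i)) (incVec R (ends i))) = 0 := by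
  obtain ⟨x⟩ := ‹Nonempty V›
  refine det_eq_zero_of_mulVec_eq_zero_of_apply_eq_one _ (c := 1) ?_ (x := x) rfl
  rw [sum_vecMulVec_mulVec]
  exact Finset.sum_eq_zero fun i _ => by simp [incVec_dotProduct]

/-- The indicator of the nodes not connected to `r` is constant along every branch of `T` and zero
at `r`, so it is a nonzero kernel vector unless the ring is trivial. -/
theorem det_sum_incVec_add_of_ne_top (ends : I → Sym2 V) (T : Finset I) (r : V)
    (h : branchSetoid ends T ≠ ⊤) :
    det (∑ i ∈ T, vecMulVec (incVec R (ends i)) (incVec R (ends i)) +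
      vecMulVec (Pi.single r 1) (Pi.single r 1)) = 0 := by
  classical
  obtain ⟨x, hx⟩ : ∃ x, ¬ branchSetoid ends T x r := by
    by_contra! hx
    exact h (eq_top_iff.2 fun x y _ => Setoid.trans' _ (hx x) (Setoid.symm' _ (hx y)))
  refine det_eq_zero_of_mulVec_eq_zero_of_apply_eq_one _
    (c := fun y => if branchSetoid ends T y r then 0 else 1) ?_ (x := x) (if_neg hx)
  rw [add_mulVec, sum_vecMulVec_mulVec, Finset.sum_eq_zero, zero_add]
  · ext y
    simp [vecMulVec_mulVec]
  · intro i hi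
    have h1 := branchSetoid_rel (T := (T : Set I)) hi (mk_out (ends i)).symm
    have h2 : branchSetoid ends T (ends i).out.1 r ↔ branchSetoid ends T (ends i).out.2 r :=
      ⟨fun h => Setoid.trans' _ (Setoid.symm' _ h1) h, fun h => Setoid.trans' _ h1 h⟩
    rw [incVec_dotProduct]
    simp [h2]

/-- After reindexing, `A` is a square integer matrix with an integer inverse. Its determinant is
`±1`, and the product squares it. -/
theorem det_mul_transpose_eq_one {J : Type*} [Fintype J] [DecidableEq J]
    (hJ : Fintype.card J = Fintype.card V) (A : Matrix V J ℤ) (B : Matrix J V ℤ)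
    (h : A * B = 1) : det (A * Aᵀ) = 1 := by
  let e : V ≃ J := Fintype.equivOfCardEq hJ.symm
  have h1 : A.submatrix id e * B.submatrix e id = 1 := by
    rw [submatrix_mul_equiv, h, submatrix_id_id]
  have h2 : A * Aᵀ = A.submatrix id e * (A.submatrix id e)ᵀ := by
    rw [transpose_submatrix, submatrix_mul_equiv, submatrix_id_id]
  have h3 := congrArg det h1
  rw [det_mul, det_one] at h3
  rw [h2, det_mul, det_transpose]
  rcases Int.isUnit_iff.1 (IsUnit.of_mul_eq_one _ h3) with h | h <;> rw [h] <;> rfl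

theorem det_sum_incVec_add_int (ends : I → Sym2 V) (T : Finset I) (r : V)
    (hT : T.card + 1 = Fintype.card V) (h : branchSetoid ends T = ⊤) :
    det (∑ i ∈ T, vecMulVec (incVec ℤ (ends i)) (incVec ℤ (ends i)) +
      vecMulVec (Pi.single r 1) (Pi.single r 1)) = 1 := by
  classical
  let A : Matrix V (Option T) ℤ :=
    of fun x o => o.elim ((Pi.single r 1 : V → ℤ) x) fun i => incVec ℤ (ends i) x
  have hA : ∑ i ∈ T, vecMulVec (incVec ℤ (ends i)) (incVec ℤ (ends i)) +
      vecMulVec (Pi.single r 1) (Pi.single r 1) = A * Aᵀ := by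
    ext x y
    rw [mul_apply, Fintype.sum_option, add_comm, Matrix.add_apply, Matrix.sum_apply,
      ← Finset.sum_coe_sort]
    rfl
  -- Nodes are related when `e_x - e_y` is an integer combination of the columns of `A`. This
  -- contains all branches of `T`, hence all pairs; with the column `e_r`, every `e_x` is reached
  -- and `A` has a right inverse.
  let ρ : Setoid V :=
    { r := fun x y => ∃ z, A *ᵥ z = Pi.single x 1 - Pi.single y 1
      iseqv :=
        { refl := fun x => ⟨0, by simp⟩
          symm := fun ⟨z, hz⟩ => ⟨-z, by rw [mulVec_neg, hz, neg_sub]⟩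
          trans := fun ⟨z, hz⟩ ⟨z', hz'⟩ => ⟨z + z', by rw [mulVec_add, hz, hz']; abel⟩ } }
  have hρ : ρ = ⊤ := by
    refine top_le_iff.1 (h ▸ branchSetoid_le_iff.2 fun i hi x y hxy => ?_)
    have h1 : A *ᵥ Pi.single (some ⟨i, hi⟩) 1 = incVec ℤ (ends i) := by
      ext v
      simp [A]
    rw [hxy] at h1
    rcases incVec_mk (R := ℤ) x y with h2 | h2
    · exact ⟨_, h1.trans h2⟩
    · exact ⟨-_, by rw [mulVec_neg, h1, h2, neg_neg]⟩
  have hr : A *ᵥ Pi.single none 1 = Pi.single r 1 := by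
    ext v
    simp [A]
  have hB : ∀ x, ∃ z, A *ᵥ z = Pi.single x 1 := by
    intro x
    obtain ⟨z, hz⟩ : ρ x r := hρ ▸ trivial
    exact ⟨z + Pi.single none 1, by rw [mulVec_add, hz, hr, sub_add_cancel]⟩
  choose b hb using hB
  rw [hA]
  refine det_mul_transpose_eq_one ?_ A (of fun o x => b x o) ?_
  · rw [Fintype.card_option, Fintype.card_coe, hT]
  · ext x y
    have := congrFun (hb y) x
    rw [one_apply, ← Pi.single_apply, ← this]
    rfl

theorem det_sum_incVec_add (ends : I → Sym2 V) (T : Finset I) (r : V)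
    (hT : T.card + 1 = Fintype.card V) (h : branchSetoid ends T = ⊤) :
    det (∑ i ∈ T, vecMulVec (incVec R (ends i)) (incVec R (ends i)) +
      vecMulVec (Pi.single r 1) (Pi.single r 1)) = 1 := by
  have := congrArg (Int.castRingHom R) (det_sum_incVec_add_int ends T r hT h)
  rw [map_one, RingHom.map_det] at this
  refine Eq.trans (congrArg det ?_) this
  ext x y
  simp [Matrix.sum_apply, vecMulVec_apply, map_incVec, Pi.single_apply]

/-- The weighted matrix tree theorem. -/
theorem treeSum_bot [Fintype I] (ends : I → Sym2 V) (w : I → R) (r : V) :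
    treeSum ⊥ ends w =
      det (∑ i, w i • vecMulVec (incVec R (ends i)) (incVec R (ends i)) +
        vecMulVec (Pi.single r 1) (Pi.single r 1)) := by
  classical
  have : Nonempty V := ⟨r⟩
  have hV : Nat.card (Quotient (⊥ : Setoid V)) = Fintype.card V := by
    rw [card_quotient_bot, Nat.card_eq_fintype_card]
  -- The grounding vector `e_r` enters as an extra index `none` of weight `1`. Index sets without it
  -- contribute zero, since the constants are in the kernel; the others are `T` together with
  -- `none`, which accounts for `T.card + 1`.
  have h := det_sum_smul_vecMulVec
    (fun o : Option I => o.elim (Pi.single r 1) fun i => incVec R (ends i))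
    (fun o : Option I => o.elim 1 w)
  rw [Fintype.sum_option, add_comm] at h
  simp only [Option.elim, one_smul] at h
  rw [h, Finset.powersetCard_eq_filter, Finset.powerset_univ, Finset.sum_filter,
    sum_finset_option, Finset.sum_eq_zero, zero_add, treeSum]
  · refine Finset.sum_congr rfl fun T _ => ?_
    rw [Finset.card_insertNone, Finset.prod_insertNone, Finset.sum_insertNone,
      add_comm (vecMulVec _ _), hV, bot_sup_eq]
    by_cases h1 : T.card + 1 = Fintype.card V
    · by_cases h2 : branchSetoid ends T = ⊤
      · simp [h1, h2, det_sum_incVec_add]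
      · simp [h1, h2, det_sum_incVec_add_of_ne_top]
    · simp [h1]
  · intro T _
    simp only [Finset.sum_map, Function.Embedding.some_apply, det_sum_incVec_eq_zero]
    simp

end MatrixTree

/-! ### Kirchhoff characteristics as tree sums. -/

section Kappa

variable {V B R : Type*}

theorem connected_fromEdgeSet_iff (ends : B → Sym2 V) (T : Set B) :
    (SimpleGraph.fromEdgeSet (ends '' T)).Connected ↔ Nonempty V ∧ branchSetoid ends T = ⊤ := by
  rw [SimpleGraph.connected_iff, and_comm]
  refine and_congr_right fun _ => ?_
  have : (SimpleGraph.fromEdgeSet (ends '' T)).reachableSetoid = branchSetoid ends T := by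
    refine le_antisymm ?_ (branchSetoid_le_iff.2 fun i hi x y hxy => ?_)
    · intro x y ⟨p⟩
      induction p with
      | nil => exact Setoid.refl' _ _
      | cons h _ ih =>
        obtain ⟨⟨i, hi, hxy⟩, -⟩ := (SimpleGraph.fromEdgeSet_adj _).1 h
        exact Setoid.trans' _ (branchSetoid_rel hi hxy) ih
    · by_cases h : x = y
      · subst h
        exact Setoid.refl' _ _
      · exact SimpleGraph.Adj.reachable ((SimpleGraph.fromEdgeSet_adj _).2 ⟨⟨i, hi, hxy⟩, h⟩)
  rw [← this, eq_top_iff]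
  exact ⟨fun h x y _ => h x y, fun h x y => h trivial⟩

theorem isSpanningTree_iff [Finite V] (N : Network V B R) (T : Finset B) :
    N.IsSpanningTree T ↔ T.card + 1 = Nat.card V ∧ branchSetoid N.ends T = ⊤ := by
  classical
  have hE : Nat.card (SimpleGraph.fromEdgeSet (N.ends '' T)).edgeSet =
      (T.image N.ends).card := by
    rw [SimpleGraph.edgeSet_fromEdgeSet, sdiff_eq_left.2, ← Finset.coe_image,
      Nat.card_coe_set_eq, Set.ncard_coe_finset]
    rw [Set.disjoint_left]
    rintro _ ⟨b, -, rfl⟩ h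
    exact N.not_isDiag b h
  rw [IsSpanningTree, SimpleGraph.isTree_iff_connected_and_card, connected_fromEdgeSet_iff, hE]
  constructor
  · rintro ⟨hinj, ⟨-, htop⟩, hcard⟩
    rw [Finset.card_image_iff.2 hinj] at hcard
    exact ⟨hcard, htop⟩
  · rintro ⟨hcard, htop⟩
    have hne : Nonempty V := (Nat.card_pos_iff.1 (by omega)).1
    -- Connectedness needs at least `T.card` distinct edges, so no two branches of `T` can be
    -- parallel.
    have h1 := ((connected_fromEdgeSet_iff _ _).2 ⟨hne, htop⟩).card_vert_le_card_edgeSet_add_one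
    rw [hE] at h1
    have h2 : (T.image N.ends).card ≤ T.card := Finset.card_image_le
    have h3 : (T.image N.ends).card = T.card := by omega
    exact ⟨Finset.card_image_iff.1 h3, ⟨hne, htop⟩, by omega⟩

theorem kappa_eq_sum [Finite V] [Fintype B] [CommRing R] (N : Network V B R)
    [DecidablePred fun T : Finset B => T.card + 1 = Nat.card V ∧ branchSetoid N.ends T = ⊤] :
    N.kappa = ∑ T : Finset B,
      if T.card + 1 = Nat.card V ∧ branchSetoid N.ends T = ⊤ then ∏ b ∈ T, N.adm b else 0 := by
  classical
  rw [kappa, finsum_eq_sum_of_fintype]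
  refine Finset.sum_congr rfl fun T _ => ?_
  rw [finsum_eq_if]
  exact if_congr (isSpanningTree_iff N T) rfl rfl

theorem kappa_eq_treeSum [Finite V] [Fintype B] [CommRing R] (N : Network V B R) :
    N.kappa = treeSum ⊥ N.ends N.adm := by
  classical
  rw [kappa_eq_sum, treeSum, card_quotient_bot]
  simp only [bot_sup_eq]

theorem comap_branchSetoid_contract (N : Network V B R) (S : Set (V × V))
    (T : Set {b : B // ¬ ((N.ends b).map (Quotient.mk (identify S))).IsDiag}) :
    (branchSetoid (N.contract S).ends T).comap (Quotient.mk (identify S)) =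
      identify S ⊔ branchSetoid N.ends (Subtype.val '' T) := by
  refine le_antisymm ?_ (sup_le (fun x y h => ?_) (branchSetoid_le_iff.2 ?_))
  · let ρ : Setoid V := identify S ⊔ branchSetoid N.ends (Subtype.val '' T)
    have hS : ∀ {x y : V}, Quotient.mk (identify S) x = Quotient.mk (identify S) y → ρ x y :=
      fun h => (le_sup_left : identify S ≤ ρ) (Quotient.exact h)
    -- The relation `ρ` contains `identify S`, so it descends to the contracted nodes.
    let ρ' : Setoid (Quotient (identify S)) :=
      { r := fun X Y => ∀ x y, Quotient.mk _ x = X → Quotient.mk _ y = Y → ρ x y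
        iseqv :=
          { refl := fun _ _ _ hx hy => hS (hx.trans hy.symm)
            symm := fun h x y hx hy => Setoid.symm' _ (h y x hy hx)
            trans := fun {_ Y _} h h' x z hx hz => by
              obtain ⟨y, hy⟩ := Quotient.mk_surjective Y
              exact Setoid.trans' _ (h x y hx hy) (h' y z hy hz) } }
    have hle : branchSetoid (N.contract S).ends T ≤ ρ' := by
      refine branchSetoid_le_iff.2 fun b hb X Y hXY x y hx hy => ?_
      obtain ⟨u, v, huv⟩ : ∃ u v, N.ends b.1 = s(u, v) :=
        (N.ends b.1).ind fun u v => ⟨u, v, rfl⟩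
      have hρ : ρ u v := (le_sup_right : branchSetoid N.ends (Subtype.val '' T) ≤ ρ)
        (branchSetoid_rel (Set.mem_image_of_mem _ hb) huv)
      have h : (N.ends b.1).map (Quotient.mk (identify S)) = s(X, Y) := hXY
      rw [huv, Sym2.map_mk] at h
      rcases Sym2.eq_iff.1 h with ⟨h1, h2⟩ | ⟨h1, h2⟩
      · exact Setoid.trans' _ (hS (hx.trans h1.symm)) (Setoid.trans' _ hρ (hS (h2.trans hy.symm)))
      · exact Setoid.trans' _ (hS (hx.trans h2.symm))
          (Setoid.trans' _ (Setoid.symm' _ hρ) (hS (h1.trans hy.symm)))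
    exact fun x y h => hle h x y rfl rfl
  · rw [Setoid.comap_rel, Quotient.sound h]
  · rintro _ ⟨b, hb, rfl⟩ x y hxy
    refine branchSetoid_rel hb ?_
    change (N.ends b.1).map _ = _
    rw [hxy, Sym2.map_mk]

theorem branchSetoid_contract_eq_top_iff (N : Network V B R) (S : Set (V × V))
    (T : Set {b : B // ¬ ((N.ends b).map (Quotient.mk (identify S))).IsDiag}) :
    branchSetoid (N.contract S).ends T = ⊤ ↔
      identify S ⊔ branchSetoid N.ends (Subtype.val '' T) = ⊤ := by
  rw [← comap_branchSetoid_contract]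
  constructor
  · intro h
    rw [h]
    rfl
  · intro h
    refine eq_top_iff.2 fun X Y _ => ?_
    induction X using Quotient.inductionOn with | h x => ?_
    induction Y using Quotient.inductionOn with | h y => ?_
    exact (eq_top_iff.1 h : _) (trivial : (⊤ : Setoid V) x y)

theorem kappa_contract [Finite V] [Fintype B] [CommRing R] (N : Network V B R)
    (S : Set (V × V)) : (N.contract S).kappa = treeSum (identify S) N.ends N.adm := by
  classical
  rw [kappa_eq_sum, treeSum]
  refine (Finset.sum_of_injOn (fun T => T.map (Function.Embedding.subtype _))
    (Finset.map_injective _).injOn (by simp) ?_ ?_)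
  · intro T _ hT
    refine if_neg fun ⟨hcard, htop⟩ => ?_
    -- A set not coming from the contracted network contains a branch that has become a loop.
    -- Without it the remaining branches still connect everything, but they are one too few.
    obtain ⟨b, hb, hd⟩ : ∃ b ∈ T, ((N.ends b).map (Quotient.mk (identify S))).IsDiag := by
      by_contra! h
      refine hT ⟨T.subtype _, by simp, ?_⟩
      exact Finset.subtype_map_of_mem h
    obtain ⟨u, v, huv⟩ : ∃ u v, N.ends b = s(u, v) :=
      (N.ends b).ind fun u v => ⟨u, v, rfl⟩
    rw [huv, Sym2.map_mk, Sym2.mk_isDiag_iff] at hd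
    have hd : identify S u v := Quotient.exact hd
    rw [← Finset.insert_erase hb, Finset.coe_insert, branchSetoid_insert _ _ huv, ← sup_assoc,
      sup_identify_singleton_of_rel hd] at htop
    have := card_quotient_le_card_add_one _ htop
    have := Finset.card_erase_add_one hb
    omega
  · intro T _
    rw [Finset.card_map, Finset.prod_map, Finset.coe_map]
    exact if_congr (and_congr_right' (branchSetoid_contract_eq_top_iff N S T)) rfl rfl

end Kappa

/-! ### The admittance matrix and the main identity. -/

open Matrix

variable {V B R : Type*} [CommRing R] [Fintype B]

theorem incVec_mul_incVec [DecidableEq V] (e : Sym2 V) (he : ¬ e.IsDiag) (x y : V) :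
    incVec R e x * incVec R e y =
      if x = y then if x ∈ e then 1 else 0 else if e = s(x, y) then -1 else 0 := by
  induction e with | h a b => ?_
  rw [Sym2.mk_isDiag_iff] at he
  have h := congrFun₂ (vecMulVec_incVec_mk (R := R) a b) x y
  rw [vecMulVec_apply, vecMulVec_apply] at h
  rw [h]
  by_cases hxy : x = y
  · subst hxy
    by_cases hxa : x = a
    · subst hxa; simp [he]
    · by_cases hxb : x = b
      · subst hxb; simp [hxa]
      · simp [hxa, hxb]
  · rw [if_neg hxy]
    simp only [Pi.sub_apply, Pi.single_apply, Sym2.eq_iff]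
    by_cases hxa : x = a
    · subst hxa
      by_cases hyb : y = b
      · subst hyb; simp [he, Ne.symm he]
      · simp [he, hyb, hxy, Ne.symm hxy, Ne.symm hyb]
    · by_cases hxb : x = b
      · subst hxb
        by_cases hya : y = a
        · subst hya; simp [hxy, Ne.symm hxy]
        · simp [hxa, hya, Ne.symm hxy, Ne.symm hxa, Ne.symm hya]
      · simp [hxa, hxb, Ne.symm hxa, Ne.symm hxb]

theorem admittanceMatrix_eq_sum [DecidableEq V] (N : Network V B R) :
    N.admittanceMatrix =
      ∑ b, N.adm b • vecMulVec (incVec R (N.ends b)) (incVec R (N.ends b)) := by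
  ext x y
  rw [Matrix.sum_apply]
  simp only [Matrix.smul_apply, vecMulVec_apply, smul_eq_mul,
    incVec_mul_incVec _ (N.not_isDiag _), admittanceMatrix, of_apply]
  split_ifs with h
  · simp [Finset.sum_filter]
  · rw [Finset.sum_filter, ← Finset.sum_neg_distrib]
    exact Finset.sum_congr rfl fun b _ => by split_ifs <;> simp

theorem isSymm_admittanceMatrix [DecidableEq V] (N : Network V B R) :
    N.admittanceMatrix.IsSymm := by
  rw [admittanceMatrix_eq_sum, Matrix.IsSymm, transpose_sum]
  simp [transpose_smul, transpose_vecMulVec]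

theorem admittanceMatrix_mulVec_one [Fintype V] [DecidableEq V] (N : Network V B R) :
    N.admittanceMatrix *ᵥ 1 = 0 := by
  rw [admittanceMatrix_eq_sum, sum_mulVec]
  refine Finset.sum_eq_zero fun b _ => ?_
  ext x
  simp [smul_mulVec, vecMulVec_mulVec, incVec_dotProduct]

theorem kappa_contract_mul_kappa_contract_sub_of_ne {n : ℕ} (N : Network (Fin n) B R)
    {j k p q : Fin n} (hjk : j ≠ k) (hpq : p ≠ q) (hpairs : s(j, k) ≠ s(p, q)) :
    (N.contract {(j, k)}).kappa * (N.contract {(p, q)}).kappa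
        - N.kappa * (N.contract {(j, k), (p, q)}).kappa
      = secondCofactor N.admittanceMatrix p q j k ^ 2 := by
  set Y := N.admittanceMatrix with hY
  set M := Y + vecMulVec (Pi.single q 1) (Pi.single q 1) with hM
  set u : Fin n → R := Pi.single j 1 - Pi.single k 1 with hu
  set v : Fin n → R := Pi.single p 1 - Pi.single q 1 with hv
  have hsymm : M.IsSymm :=
    N.isSymm_admittanceMatrix.add (by rw [Matrix.IsSymm, transpose_vecMulVec])
  have hr := N.admittanceMatrix_mulVec_one
  have hc : 1 ᵥ* Y = 0 := by
    rw [← mulVec_transpose, N.isSymm_admittanceMatrix.eq, hr]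
  have hbot : ∀ {a b : Fin n}, a ≠ b → ¬ (⊥ : Setoid (Fin n)) a b := fun h => h
  -- The only place where distinctness of the pairs enters: after contracting `(j, k)`, the branch
  -- `(p, q)` is not a loop, so it can again be deleted or contracted.
  have hpq' : ¬ (⊥ ⊔ identify {(j, k)} : Setoid (Fin n)) p q := by
    rw [bot_sup_eq]
    exact fun h => hpairs (sym2_eq_of_identify_singleton h hpq).symm
  have h0 : N.kappa = M.det := by
    rw [kappa_eq_treeSum, treeSum_bot _ _ q, ← admittanceMatrix_eq_sum]
  have hmat : ∀ a b : Fin n, treeSum ⊥ (fun o : Option B => o.elim s(a, b) N.ends)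
      (fun o => o.elim 1 N.adm) = det (M + vecMulVec (Pi.single a 1 - Pi.single b 1)
        (Pi.single a 1 - Pi.single b 1)) := by
    intro a b
    rw [treeSum_bot _ _ q, Fintype.sum_option]
    simp only [Option.elim, one_smul, vecMulVec_incVec_mk]
    rw [← admittanceMatrix_eq_sum, add_assoc, add_comm]
  have hone : ∀ {a b : Fin n}, a ≠ b →
      N.kappa + (N.contract {(a, b)}).kappa = det (M + vecMulVec (Pi.single a 1 - Pi.single b 1)
        (Pi.single a 1 - Pi.single b 1)) := by
    intro a b h
    rw [← hmat, treeSum_option (hbot h), kappa_contract, kappa_eq_treeSum, bot_sup_eq]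
  have htwo : N.kappa + (N.contract {(j, k)}).kappa + ((N.contract {(p, q)}).kappa +
      (N.contract {(j, k), (p, q)}).kappa) = det (M + vecMulVec u u + vecMulVec v v) := by
    have h1 : treeSum ⊥ (fun o : Option (Option B) => o.elim s(j, k)
        fun o : Option B => o.elim s(p, q) N.ends)
        (fun o => o.elim 1 fun o : Option B => o.elim 1 N.adm) =
          det (M + vecMulVec u u + vecMulVec v v) := by
      rw [treeSum_bot _ _ q, Fintype.sum_option, Fintype.sum_option]
      simp only [Option.elim, one_smul, vecMulVec_incVec_mk]
      rw [← admittanceMatrix_eq_sum]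
      exact congrArg det (by rw [hM, hY, hu, hv]; abel)
    rw [← h1, treeSum_option (hbot hjk), treeSum_option (hbot hpq), treeSum_option hpq',
      kappa_contract, kappa_contract, kappa_contract, kappa_eq_treeSum, identify_insert,
      bot_sup_eq, bot_sup_eq]
    ring
  have hcof : (v ⬝ᵥ (M.adjugate *ᵥ u)) ^ 2 = secondCofactor Y p q j k ^ 2 := by
    rw [← sq_det_updateRow_updateRow Y hpq hjk, ← dotProduct_adjugate_mulVec_sub_single Y hr hc hpq,
      ← hM, ← hu, ← hv, dotProduct_mulVec u, ← mulVec_transpose, adjugate_transpose, hsymm.eq,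
      dotProduct_comm v]
  have key := det_mul_det_add_vecMulVec_add_vecMulVec M hsymm u v
  rw [hcof, ← htwo, ← hone hjk, ← hone hpq, ← h0] at key
  linear_combination -key

theorem kappa_contract_mul_kappa_contract_sub {n : ℕ} (N : Network (Fin n) B R)
    {j k p q : Fin n} (hpairs : s(j, k) ≠ s(p, q)) :
    (N.contract {(j, k)}).kappa * (N.contract {(p, q)}).kappa
        - N.kappa * (N.contract {(j, k), (p, q)}).kappa
      = secondCofactor N.admittanceMatrix p q j k ^ 2 := by
  -- For a degenerate pair the contraction has no effect and the cofactor is `0` by convention, so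
  -- both sides vanish.
  by_cases hjk : j = k
  · subst hjk
    rw [secondCofactor, dif_neg fun h => h.2 rfl, kappa_contract, kappa_contract, kappa_contract,
      kappa_eq_treeSum, identify_insert, identify_singleton_self, bot_sup_eq]
    ring
  by_cases hpq : p = q
  · subst hpq
    rw [secondCofactor, dif_neg fun h => h.1 rfl, kappa_contract, kappa_contract, kappa_contract,
      kappa_eq_treeSum, identify_insert, identify_singleton_self, sup_bot_eq]
    ring
  exact kappa_contract_mul_kappa_contract_sub_of_ne N hjk hpq hpairs

end Network

theorem mainTheorem5 {R : Type*} [CommRing R] {B : Type*} [Fintype B] (n : ℕ) (hn : 3 ≤ n)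
    (j k p q : Fin n) (hpairs : s(j, k) ≠ s(p, q)) :
    (∀ N : Network (Fin n) B R,
      (N.contract {(j, k)}).kappa * (N.contract {(p, q)}).kappa
          - N.kappa * (N.contract {(j, k), (p, q)}).kappa
        = secondCofactor N.admittanceMatrix p q j k ^ 2) ∧
    (∀ N : Network (Fin n) B ℝ,
      0 ≤ (N.contract {(j, k)}).kappa * (N.contract {(p, q)}).kappa
          - N.kappa * (N.contract {(j, k), (p, q)}).kappa ∧
      ((N.contract {(j, k)}).kappa * (N.contract {(p, q)}).kappa
          - N.kappa * (N.contract {(j, k), (p, q)}).kappa = 0 ↔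
        N.IsConjugate j k p q)) := by
  refine ⟨fun N => N.kappa_contract_mul_kappa_contract_sub hpairs, fun N => ?_⟩
  rw [N.kappa_contract_mul_kappa_contract_sub hpairs]
  exact ⟨sq_nonneg _, sq_eq_zero_iff⟩
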